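/- Let $F$ be a field of characteristic $0$ with algebraic closure $\overline F$, let $G\subset \mathrm{GL}(n,\overline F)$ be an algebraic group defined over $F$, and let $\mathfrak g=\mathrm{Lie}(G)\subset\mathfrak{gl}(n,F)$. Let $\mathfrak s$ be the solvable radical of $\mathfrak g$, and let $\mathfrak n$ be the largest ideal of $\mathfrak g$ consisting of nilpotent matrices. Let $\mathfrak h'$ be a Cartan subalgebra of $\mathfrak s$ with basis $a_1,\dots,a_r$, and let $a_i=s_i+n_i$ be the Jordan decomposition of the matrix $a_i$ ($s_i$ semisimple, $n_i$ nilpotent, $s_in_i=n_is_i$). Let $\mathfrak s_1(\mathfrak h')=\bigcap_{k>0}[\mathfrak h'^k,\mathfrak s]$, where $[\mathfrak h'^k,\mathfrak s]=[\mathfrak h',[\mathfrak h',\cdots,[\mathfrak h',\mathfrak s]\cdots]]$ ($k$ factors $\mathfrak h'$), be the Fitting $1$-component of $\mathfrak s$ with respect to the adjoint action of $\mathfrak h'$. For an abelian subalgebra $\mathfrak d'\subset\mathfrak s$ consisting of semisimple matrices, consider the property $$(\ast)\qquad \mathfrak s=\mathfrak d'\oplus\mathfrak n \ \text{ as vector spaces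 (a semidirect sum)},\qquad \mathfrak h'=C_{\mathfrak s}(\mathfrak d')=\mathfrak d'+C_{\mathfrak n}(\mathfrak d').$$ Then abelian subalgebras $\mathfrak d'$ of $\mathfrak s$ consisting of semisimple matrices and satisfying $(\ast)$ exist, and every such $\mathfrak d'$ is spanned by $s_1,\dots,s_r$. Moreover, $\mathfrak n$ is spanned by $n_1,\dots,n_r$ along with $\mathfrak s_1(\mathfrak h')$. -/

import Mathlib

open MvPolynomial

-- The commutator bracket `⁅A, B⁆ = A * B - B * A` on matrices.
attribute [local instance] LieRing.ofAssociativeRing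

/-! ### Linear algebraic groups and their Lie algebras -/

section AlgebraicGroups

variable {n : ℕ} {K : Type*} [Field K]

/-- The matrix `A` as a point of affine `n²`-space, the coordinates being indexed by positions. -/
def matrixPoint (A : Matrix (Fin n) (Fin n) K) : Fin n × Fin n → K := fun p => A p.1 p.2

/-- A subgroup `G` of `GL(n, K)` is algebraic if it consists of those `g` in `GL(n, K)` at which
all the polynomials of some set `S ⊆ K[x₁₁, …, xₙₙ]` vanish. -/
def IsAlgebraicSubgroup (G : Subgroup (GL (Fin n) K)) : Prop :=
  ∃ S : Set (MvPolynomial (Fin n × Fin n) K), ∀ g : GL (Fin n) K,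
    g ∈ G ↔ ∀ f ∈ S, eval (matrixPoint g.val) f = 0

/-- The ideal `I(G) ⊆ K[x₁₁, …, xₙₙ]` of all polynomials that vanish on `G`. -/
noncomputable def groupIdeal (G : Subgroup (GL (Fin n) K)) :
    Ideal (MvPolynomial (Fin n × Fin n) K) :=
  vanishingIdeal K {x | ∃ g ∈ G, x = matrixPoint g.val}

/-- `G` is defined over the subfield `F` of `K` if `I(G)` is generated by polynomials with
coefficients in `F`. -/
def IsDefinedOver (F : Type*) [Field F] [Algebra F K] (G : Subgroup (GL (Fin n) K)) : Prop :=
  ∃ T : Set (MvPolynomial (Fin n × Fin n) F),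
    groupIdeal G = Ideal.span (MvPolynomial.map (algebraMap F K) '' T)

/-- The differential at the identity matrix of the polynomial function `f`, applied to the tangent
vector `X`: this is `∑ i j, (∂f/∂x_{ij})(1) * X_{ij}`. -/
noncomputable def diffAtOne (f : MvPolynomial (Fin n × Fin n) K) (X : Matrix (Fin n) (Fin n) K) :
    K :=
  ∑ p : Fin n × Fin n, eval (matrixPoint 1) (pderiv p f) * X p.1 p.2

/-- The left-invariant derivation of the polynomial ring with `x_{ij} ↦ ∑ k, x_{ik} A_{kj}`
(auxiliary, for the closure of the tangent space at `1` under brackets). -/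
noncomputable def invDerivation (A : Matrix (Fin n) (Fin n) K) :
    Derivation K (MvPolynomial (Fin n × Fin n) K) (MvPolynomial (Fin n × Fin n) K) :=
  mkDerivation K fun p => ∑ k, X (p.1, k) * C (A k p.2)

lemma invDerivation_X (A : Matrix (Fin n) (Fin n) K) (p : Fin n × Fin n) :
    invDerivation A (X p) = ∑ k, X (p.1, k) * C (A k p.2) := by
  simp [invDerivation, mkDerivation_X]

lemma invDerivation_sub_lie (A B : Matrix (Fin n) (Fin n) K)
    (f : MvPolynomial (Fin n × Fin n) K) :
    invDerivation ⁅A, B⁆ f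
      = invDerivation A (invDerivation B f) - invDerivation B (invDerivation A f) := by
  have key : ∀ (A B : Matrix (Fin n) (Fin n) K) (p : Fin n × Fin n),
      invDerivation A (invDerivation B (X p)) = invDerivation (A * B) (X p) := by
    intro A B p
    simp only [invDerivation_X, map_sum, Derivation.leibniz, smul_eq_mul, derivation_C, mul_zero,
      zero_add, Matrix.mul_apply, Finset.mul_sum, map_mul]
    rw [Finset.sum_comm]
    refine Finset.sum_congr rfl fun k _ => Finset.sum_congr rfl fun l _ => by ring
  have h : invDerivation ⁅A, B⁆ = ⁅invDerivation A, invDerivation B⁆ := by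
    refine MvPolynomial.derivation_ext fun p => ?_
    rw [Derivation.commutator_apply, key, key]
    simp only [invDerivation_X, LieRing.of_associative_ring_bracket, Matrix.sub_apply, map_sub,
      mul_sub, Finset.sum_sub_distrib]
  rw [h, Derivation.commutator_apply]

lemma eval_one_invDerivation (A : Matrix (Fin n) (Fin n) K)
    (f : MvPolynomial (Fin n × Fin n) K) :
    eval (matrixPoint 1) (invDerivation A f) = diffAtOne f A := by
  unfold diffAtOne invDerivation
  induction f using MvPolynomial.induction_on with
  | C a => simp
  | add p q hp hq => simp only [map_add, hp, hq, add_mul, Finset.sum_add_distrib]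
  | mul_X p i hp =>
    simp only [Derivation.leibniz, smul_eq_mul, map_add, map_mul, hp, mkDerivation_X, add_mul,
      Finset.sum_add_distrib, pderiv_X, map_sum, eval_X, eval_C]
    congr 1
    · simp [matrixPoint, Matrix.one_apply, Pi.single_apply, apply_ite]
    · rw [Finset.mul_sum]
      exact Finset.sum_congr rfl fun _ _ => by ring

lemma invDerivation_mem_groupIdeal {G : Subgroup (GL (Fin n) K)} {A : Matrix (Fin n) (Fin n) K}
    (hA : ∀ f ∈ groupIdeal G, diffAtOne f A = 0) {f : MvPolynomial (Fin n × Fin n) K}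
    (hf : f ∈ groupIdeal G) : invDerivation A f ∈ groupIdeal G := by
  rintro _ ⟨g, hg, rfl⟩
  let φ : MvPolynomial (Fin n × Fin n) K →ₐ[K] MvPolynomial (Fin n × Fin n) K :=
    aeval fun p => ∑ k, C (g.val p.1 k) * X (k, p.2)
  have hφ : ∀ (B : Matrix (Fin n) (Fin n) K) (q : MvPolynomial (Fin n × Fin n) K),
      eval (matrixPoint B) (φ q) = eval (matrixPoint (g.val * B)) q := by
    intro B q
    induction q using MvPolynomial.induction_on with
    | C a => simp [φ]
    | add p q hp hq => simp only [map_add, hp, hq]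
    | mul_X p i hp =>
      simp only [map_mul, hp, eval_X]
      congr 1
      simp [φ, matrixPoint, Matrix.mul_apply]
  have hcomm : ∀ q : MvPolynomial (Fin n × Fin n) K,
      φ (invDerivation A q) = invDerivation A (φ q) := by
    intro q
    induction q using MvPolynomial.induction_on with
    | C a => simp [φ, derivation_C]
    | add p q hp hq => simp only [map_add, hp, hq]
    | mul_X p i hp =>
      have hX : φ (invDerivation A (X i)) = invDerivation A (φ (X i)) := by
        simp only [invDerivation_X, map_sum, map_mul, φ, aeval_X, aeval_C, Derivation.leibniz,
          smul_eq_mul, derivation_C, mul_zero, add_zero, Finset.sum_mul, Finset.mul_sum,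
          algebraMap_eq]
        rw [Finset.sum_comm]
        refine Finset.sum_congr rfl fun k _ => Finset.sum_congr rfl fun l _ => by ring
      simp only [Derivation.leibniz, smul_eq_mul, map_add, map_mul, hp, hX]
  have hφf : φ f ∈ groupIdeal G := by
    rintro _ ⟨h, hh, rfl⟩
    have := hf _ ⟨g * h, G.mul_mem hg hh, rfl⟩
    simpa [aeval_eq_eval, hφ] using this
  have := hA _ hφf
  rw [← eval_one_invDerivation, ← hcomm, hφ, mul_one] at this
  simpa [aeval_eq_eval] using this

/-- For `F ⊆ K` and a subgroup `G` of `GL(n, K)`: the Lie subalgebra of `gl(n, F)` formed by the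
matrices over `F` that are tangent to `G` at the identity, i.e. the `X` such that
`∑ i j, (∂f/∂x_{ij})(1) * X_{ij} = 0` for all `f ∈ I(G)`. For `F = K` this is the Lie algebra of
the algebraic group `G`; if `G` is defined over `F`, it is the Lie algebra of `G` as a subalgebra
of `gl(n, F)`. -/
noncomputable def groupLieAlgebra (F : Type*) [Field F] [Algebra F K]
    (G : Subgroup (GL (Fin n) K)) : LieSubalgebra F (Matrix (Fin n) (Fin n) F) where
  carrier := {X | ∀ f ∈ groupIdeal G, diffAtOne f (X.map (algebraMap F K)) = 0}
  zero_mem' := fun f _ => by simp [diffAtOne]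
  add_mem' := fun {X Y} hX hY f hf => by
    have hX := hX f hf
    have hY := hY f hf
    simp only [diffAtOne, Matrix.map_apply, Matrix.add_apply, map_add, mul_add,
      Finset.sum_add_distrib] at hX hY ⊢
    rw [hX, hY, add_zero]
  smul_mem' := fun c X hX f hf => by
    have hX := hX f hf
    simp only [diffAtOne, Matrix.map_apply, Matrix.smul_apply, smul_eq_mul, map_mul,
      mul_left_comm _ (algebraMap F K c), ← Finset.mul_sum] at hX ⊢
    rw [hX, mul_zero]
  lie_mem' := fun {X Y} hX hY f hf => by
    have h : (⁅X, Y⁆).map (algebraMap F K) = ⁅X.map (algebraMap F K), Y.map (algebraMap F K)⁆ := by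
      simp only [LieRing.of_associative_ring_bracket, Matrix.map_mul, Matrix.map_sub _ (map_sub _)]
    rw [h, ← eval_one_invDerivation, invDerivation_sub_lie, map_sub, eval_one_invDerivation,
      eval_one_invDerivation, hX _ (invDerivation_mem_groupIdeal hY hf),
      hY _ (invDerivation_mem_groupIdeal hX hf), sub_zero]

end AlgebraicGroups

/-! ### Jordan decomposition -/

section Jordan

variable {n : ℕ} {F : Type*} [Field F]

/-- A matrix is semisimple if every invariant subspace has an invariant complement; over a field
of characteristic zero this says that it is diagonalizable over the algebraic closure. -/
def IsSemisimpleMatrix (A : Matrix (Fin n) (Fin n) F) : Prop :=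
  Module.End.IsSemisimple (Matrix.toLin' A)

/-- `a = s + ν` is the (additive) Jordan decomposition of the matrix `a`. -/
structure IsJordanDecomposition (a s ν : Matrix (Fin n) (Fin n) F) : Prop where
  eq_add : a = s + ν
  commute : Commute s ν
  semisimple : IsSemisimpleMatrix s
  nilpotent : IsNilpotent ν

end Jordan

/-! ### The largest ideal consisting of nilpotent elements -/

section NilpotentIdeal

lemma isNilpotent_toEnd_sup {R L M : Type*} [CommRing R] [LieRing L] [LieAlgebra R L]
    [AddCommGroup M] [Module R M] [LieRingModule L M] [LieModule R L M] [IsNoetherian R M]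
    {I J : LieIdeal R L} (hI : ∀ x ∈ I, IsNilpotent (LieModule.toEnd R L M x))
    (hJ : ∀ x ∈ J, IsNilpotent (LieModule.toEnd R L M x)) :
    ∀ x ∈ I ⊔ J, IsNilpotent (LieModule.toEnd R L M x) := by
  intro x hx
  obtain ⟨i, hi, j, hj, rfl⟩ := (LieSubmodule.mem_sup _ _ _).1 hx
  obtain ⟨m, hm⟩ := hJ j hj
  have hnil : LieModule.IsNilpotent I M :=
    (LieModule.isNilpotent_iff_forall' (R := R)).2 fun y => hI y y.2
  obtain ⟨k, hk⟩ := (LieModule.isNilpotent_iff R I M).1 hnil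
  have step : ∀ (N : LieSubmodule R L M), ∀ v ∈ N, ∀ l : ℕ,
      ((LieModule.toEnd R L M (i + j)) ^ l) v - ((LieModule.toEnd R L M j) ^ l) v ∈ ⁅I, N⁆ := by
    intro N v hv l
    induction l with
    | zero => simp
    | succ l ih =>
      have hjv : ∀ l, ((LieModule.toEnd R L M j) ^ l) v ∈ N := by
        intro l
        induction l with
        | zero => simpa
        | succ l ih => rw [pow_succ']; exact N.lie_mem ih
      have h1 := LieSubmodule.lie_mem_lie hi (hjv l)
      have h2 : ⁅i + j, ((LieModule.toEnd R L M (i + j)) ^ l) v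
          - ((LieModule.toEnd R L M j) ^ l) v⁆ ∈ ⁅I, N⁆ := LieSubmodule.lie_mem _ ih
      convert add_mem h1 h2 using 1
      simp only [pow_succ', Module.End.mul_apply, LieModule.toEnd_apply_apply, lie_sub, add_lie]
      abel
  have hlcs : ∀ l : ℕ, ∀ v : M,
      ((LieModule.toEnd R L M (i + j)) ^ (m * l)) v ∈ I.lcs M l := by
    intro l
    induction l with
    | zero => intro v; simp
    | succ l ih =>
      intro v
      have := step _ _ (ih v) m
      rw [hm] at this
      rw [LieIdeal.lcs_succ, mul_add, mul_one, add_comm (m * l), pow_add, Module.End.mul_apply]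
      simpa using this
  refine ⟨m * k, LinearMap.ext fun v => ?_⟩
  have h := hlcs k v
  rw [← LieSubmodule.mem_toSubmodule, LieIdeal.coe_lcs_eq, hk] at h
  simpa using h

variable {n : ℕ} {F : Type*} [Field F]

/-- The largest ideal of the matrix Lie algebra `𝔤` that consists of nilpotent matrices; that the
supremum is itself such an ideal is `isGreatest_nilIdeal`. -/
noncomputable def nilIdeal (𝔤 : LieSubalgebra F (Matrix (Fin n) (Fin n) F)) : LieIdeal F 𝔤 :=
  sSup {I : LieIdeal F 𝔤 | ∀ x ∈ I, IsNilpotent (x : Matrix (Fin n) (Fin n) F)}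

lemma isNilpotent_toEnd_matrix_iff (𝔤 : LieSubalgebra F (Matrix (Fin n) (Fin n) F)) (x : 𝔤) :
    IsNilpotent (LieModule.toEnd F 𝔤 (Fin n → F) x) ↔
      IsNilpotent (x : Matrix (Fin n) (Fin n) F) := by
  have : LieModule.toEnd F 𝔤 (Fin n → F) x = Matrix.toLinAlgEquiv' (x : Matrix _ _ F) := by
    ext; rfl
  rw [this, IsNilpotent.map_iff (Matrix.toLinAlgEquiv' (R := F) (n := Fin n)).injective]

theorem isGreatest_nilIdeal (𝔤 : LieSubalgebra F (Matrix (Fin n) (Fin n) F)) :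
    IsGreatest {I : LieIdeal F 𝔤 | ∀ x ∈ I, IsNilpotent (x : Matrix (Fin n) (Fin n) F)}
      (nilIdeal 𝔤) := by
  refine ⟨?_, fun I hI => le_sSup hI⟩
  have hsup : ∀ I J : LieIdeal F 𝔤, (∀ x ∈ I, IsNilpotent (x : Matrix (Fin n) (Fin n) F)) →
      (∀ x ∈ J, IsNilpotent (x : Matrix (Fin n) (Fin n) F)) →
      ∀ x ∈ I ⊔ J, IsNilpotent (x : Matrix (Fin n) (Fin n) F) := by
    intro I J hI hJ x hx
    simp only [← isNilpotent_toEnd_matrix_iff] at hI hJ ⊢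
    exact isNilpotent_toEnd_sup hI hJ x hx
  obtain ⟨M, hM, hmax⟩ := (wellFounded_gt (α := LieIdeal F 𝔤)).has_min
    {I : LieIdeal F 𝔤 | ∀ x ∈ I, IsNilpotent (x : Matrix (Fin n) (Fin n) F)}
    ⟨⊥, fun x hx => by rw [(LieSubmodule.mem_bot x).1 hx]; exact IsNilpotent.zero⟩
  have : nilIdeal 𝔤 = M := by
    refine le_antisymm (sSup_le fun I hI => ?_) (le_sSup hM)
    by_contra hle
    exact hmax (I ⊔ M) (hsup I M hI hM)
      (lt_of_le_of_ne le_sup_right fun h => hle (h ▸ le_sup_left))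
  rw [this]
  exact hM

end NilpotentIdeal

/-! ### Complements of the nilpotent part in the solvable radical -/

section Radical

variable {n : ℕ} {F : Type*} [Field F] (𝔤 : LieSubalgebra F (Matrix (Fin n) (Fin n) F))

/-- The solvable radical `𝔰` of `𝔤`. -/
noncomputable abbrev solvableRadical : LieIdeal F 𝔤 := LieAlgebra.radical F 𝔤

/-- The inclusion of `𝔤` into the space of all matrices. -/
def inclLie : 𝔤 →ₗ[F] Matrix (Fin n) (Fin n) F := 𝔤.toSubmodule.subtype

/-- The inclusion of `𝔰` into `𝔤`. -/
noncomputable def inclRad : solvableRadical 𝔤 →ₗ[F] 𝔤 := (solvableRadical 𝔤).toSubmodule.subtype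

/-- `d` is an abelian subalgebra of the solvable radical `𝔰`, consisting of semisimple matrices,
such that `𝔰 = d + 𝔫` is a semidirect sum (`𝔫` being the largest ideal of `𝔤` that consists of
nilpotent matrices) and `h = C_𝔰(d) = d + C_𝔫(d)`. -/
structure IsToralComplement (h d : LieSubalgebra F (solvableRadical 𝔤)) : Prop where
  abelian : ∀ x ∈ d, ∀ y ∈ d, ⁅x, y⁆ = 0
  semisimple : ∀ x ∈ d, IsSemisimpleMatrix (inclLie 𝔤 (inclRad 𝔤 x))
  sup_eq : d.toSubmodule.map (inclRad 𝔤) ⊔ (nilIdeal 𝔤).toSubmodule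
    = (solvableRadical 𝔤).toSubmodule
  disjoint : Disjoint (d.toSubmodule.map (inclRad 𝔤)) (nilIdeal 𝔤).toSubmodule
  eq_centralizer : ∀ x, x ∈ h ↔ ∀ y ∈ d, ⁅y, x⁆ = 0
  eq_add : ∀ x, x ∈ h ↔
    ∃ y ∈ d, ∃ z, inclRad 𝔤 z ∈ nilIdeal 𝔤 ∧ (∀ w ∈ d, ⁅w, z⁆ = 0) ∧ x = y + z

end Radical

/-!
The only property of the Lie algebra `𝔤` of an algebraic group that matters is that it contains the
semisimple parts of its elements (`mem_groupLieAlgebra_of_isJordanDecomposition`). A matrix `x` is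
tangent to `G` exactly when the left-invariant derivation `D_x` of the polynomial ring preserves the
ideal `I(G)`. If `x = s + ν` is the Jordan decomposition, then over the algebraically closed field
`K` the polynomial ring is the sum of the eigenspaces of `D_s`, and these are the generalized
eigenspaces of `D_x` (`iSup_jointEigenspace_eq_top`); a subspace preserved by `D_x` contains the
components of its elements, so it is preserved by `D_s` too.

The rest is Lie theory over `F`. Write `𝔰` for the radical of `𝔤` and `𝔫` for the largest ideal of
nilpotent matrices. In characteristic zero `[𝔤, 𝔰]` acts nilpotently on every finite-dimensional
module (`isNilpotent_toEnd_of_mem_lie_of_isSolvable`, by traces on the composition factors), so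
`[𝔤, 𝔰] ⊆ 𝔫`, and `𝔫` consists of all nilpotent matrices in `𝔰` (`mem_nilIdeal_iff`). As `ad s` is a
polynomial in `ad x`, the semisimple part `s` of an element `x` of `𝔰` is central modulo `𝔰`, hence
lies in `𝔰`; if `x` lies in the Cartan subalgebra `h` of `𝔰`, then `s` centralizes `h`, hence lies
in `h`. So the semisimple matrices in `h` form a central subalgebra `d` of `h`, and every element of
`h` is the sum of an element of `d` and an element of `h ∩ 𝔫`. The Fitting decomposition
`𝔰 = h ⊕ 𝔰₁(h)` with `𝔰₁(h) ⊆ [𝔰, 𝔰] ⊆ 𝔫` then gives `𝔰 = d ⊕ 𝔫`. An element of `h` acts on the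
centralizer of `d` like its nilpotent part, so this centralizer lies in the null component `h` of
the Fitting decomposition (`isToralComplement_semisimpleSubalgebra`).

Conversely, if `d` is any toral complement, the decomposition `h = d + C_𝔫(d)` is the Jordan
decomposition of the elements of `h`; expanding in the basis and using `d ∩ 𝔫 = 0` shows that `d` is
spanned by the semisimple parts, and `𝔫` by the nilpotent parts and `𝔰₁(h)`.
-/

/-! ### The action of the ideal `[𝔤, rad 𝔤]` on a module -/

section LieTheory

/-- If all traces `tr (y * p(y))` vanish, then `y` is nilpotent: otherwise some `y * p(y)` is a
nonzero idempotent, whose trace is its rank. -/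
lemma isNilpotent_of_forall_trace_mul_aeval_eq_zero {F V : Type*} [Field F] [CharZero F]
    [AddCommGroup V] [Module F V] [FiniteDimensional F V] {y : Module.End F V}
    (hy : ∀ p : Polynomial F, LinearMap.trace F V (y * Polynomial.aeval y p) = 0) :
    IsNilpotent y := by
  obtain ⟨q, hq, hX⟩ := Polynomial.exists_eq_pow_rootMultiplicity_mul_and_not_dvd
    (minpoly F y) (minpoly.ne_zero_of_finite F y) 0
  set m := (minpoly F y).rootMultiplicity 0
  rw [Polynomial.C_0, sub_zero] at hq hX
  obtain ⟨u, v, huv⟩ : IsCoprime (Polynomial.X ^ (m + 1) : Polynomial F) q :=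
    ((Polynomial.irreducible_X.coprime_iff_not_dvd).2 hX).pow_left
  have h0 : y ^ m * Polynomial.aeval y q = 0 := by
    have := minpoly.aeval F y
    rwa [hq, map_mul, map_pow, Polynomial.aeval_X] at this
  -- `e` will be the projection onto the part of the space on which `y` is invertible.
  have hunit : Polynomial.X * (Polynomial.X ^ m * u) + q * v = 1 := by rw [← huv]; ring
  obtain ⟨e, he⟩ : ∃ e, e = Polynomial.aeval y (Polynomial.X * (Polynomial.X ^ m * u)) := ⟨_, rfl⟩
  have h1 : e + Polynomial.aeval y (q * v) = 1 := by rw [he, ← map_add, hunit, map_one]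
  have hmul : e * Polynomial.aeval y (q * v) = 0 := by
    have : Polynomial.X * (Polynomial.X ^ m * u) * (q * v)
        = Polynomial.X * u * v * (Polynomial.X ^ m * q) := by ring
    rw [he, ← map_mul, this, map_mul, map_mul _ (Polynomial.X ^ m), map_pow, Polynomial.aeval_X,
      h0, mul_zero]
  have hidem : IsIdempotentElem e := by
    have : e * (e + Polynomial.aeval y (q * v)) = e := by rw [h1, mul_one]
    rwa [mul_add, hmul, add_zero] at this
  have he0 : e = 0 := by
    have htr := hy (Polynomial.X ^ m * u)
    have hy' : y * Polynomial.aeval y (Polynomial.X ^ m * u) = e := by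
      rw [he, map_mul _ Polynomial.X, Polynomial.aeval_X]
    rw [hy', (LinearMap.IsIdempotentElem.isProj_range e hidem).trace, Nat.cast_eq_zero,
      Submodule.finrank_eq_zero, LinearMap.range_eq_bot] at htr
    exact htr
  refine ⟨m, ?_⟩
  rw [he0, zero_add] at h1
  rw [← mul_one (y ^ m), ← h1, map_mul, ← mul_assoc, h0, zero_mul]

variable {F L M : Type*} [Field F] [LieRing L] [LieAlgebra F L]
  [AddCommGroup M] [Module F M] [LieRingModule L M] [LieModule F L M]

open LieModule

/-- `tr ([a, b] s) = tr (a (b s - s b))`, which vanishes when `s` commutes with `b`. -/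
lemma trace_toEnd_mul_eq_zero_of_mem_lie {I J : LieIdeal F L}
    {s : Module.End F M} (hs : ∀ b ∈ J, Commute s (toEnd F L M b)) {y : L} (hy : y ∈ ⁅I, J⁆) :
    LinearMap.trace F M (toEnd F L M y * s) = 0 := by
  rw [← LieSubmodule.mem_toSubmodule, LieSubmodule.lieIdeal_oper_eq_linear_span'] at hy
  induction hy using Submodule.span_induction with
  | mem y hy =>
    obtain ⟨a, -, b, hb, rfl⟩ := hy
    have hc : toEnd F L M b * s = s * toEnd F L M b := (hs b hb).eq.symm
    rw [LieHom.map_lie, LieRing.of_associative_ring_bracket, sub_mul, map_sub, mul_assoc, hc,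
      ← mul_assoc, LinearMap.trace_mul_comm, mul_assoc, sub_self]
  | zero => simp
  | add x y _ _ hx hy => rw [map_add, add_mul, map_add, hx, hy, add_zero]
  | smul c x _ hx => rw [map_smul, smul_mul_assoc, map_smul, hx, smul_zero]

/-- The submodule `I M` of the simple module `M` is `0` or `M`, and not `M` by Engel's theorem. -/
lemma toEnd_eq_zero_of_isIrreducible_of_isNilpotent [FiniteDimensional F M] [IsIrreducible F L M]
    {I : LieIdeal F L} (hI : ∀ x ∈ I, IsNilpotent (toEnd F L M x)) {x : L} (hx : x ∈ I) :
    toEnd F L M x = 0 := by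
  have hnil : LieModule.IsNilpotent I M :=
    (LieModule.isNilpotent_iff_forall' (R := F)).2 fun y => hI y y.2
  obtain ⟨k, hk⟩ := (LieModule.isNilpotent_iff F I M).1 hnil
  have hk' : I.lcs M k = ⊥ := by
    rw [← LieSubmodule.toSubmodule_inj, LieIdeal.coe_lcs_eq, hk]; rfl
  rcases eq_bot_or_eq_top (⁅I, (⊤ : LieSubmodule F L M)⁆) with h | h
  · ext v
    have : ⁅x, v⁆ ∈ ⁅I, (⊤ : LieSubmodule F L M)⁆ :=
      LieSubmodule.lie_mem_lie hx (LieSubmodule.mem_top v)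
    rwa [h] at this
  · have htop : ∀ k, I.lcs M k = ⊤ := by
      intro k
      induction k with
      | zero => simp
      | succ k ih => rw [LieIdeal.lcs_succ, ih, h]
    have := LieModule.nontrivial_of_isIrreducible F L M
    exact absurd (hk'.symm.trans (htop k)) bot_ne_top

/-- Going down the derived series of `I`, each term but the first acts centrally, hence by trace
zero nilpotent operators, hence by zero. -/
lemma toEnd_eq_zero_of_isIrreducible_of_isSolvable [CharZero F] [FiniteDimensional F M]
    [IsIrreducible F L M] {I : LieIdeal F L} [LieAlgebra.IsSolvable I] {y : L}
    (hy : y ∈ ⁅(⊤ : LieIdeal F L), I⁆) : toEnd F L M y = 0 := by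
  let D := fun k => LieAlgebra.derivedSeriesOfIdeal F L k I
  have hsucc : ∀ k, D (k + 1) = ⁅D k, D k⁆ := fun k =>
    LieAlgebra.derivedSeriesOfIdeal_succ F L I k
  have key : ∀ J : LieIdeal F L, (∀ x ∈ ⁅J, J⁆, toEnd F L M x = 0) →
      ∀ x ∈ ⁅(⊤ : LieIdeal F L), J⁆, toEnd F L M x = 0 := by
    intro J hJ x hx
    refine toEnd_eq_zero_of_isIrreducible_of_isNilpotent (fun y hy => ?_) hx
    refine isNilpotent_of_forall_trace_mul_aeval_eq_zero fun p =>
      trace_toEnd_mul_eq_zero_of_mem_lie (fun b hb => ?_) hy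
    have hyJ : y ∈ J := LieSubmodule.lie_le_right _ _ hy
    have hc : Commute (toEnd F L M y) (toEnd F L M b) := by
      rw [commute_iff_lie_eq, ← LieHom.map_lie]
      exact hJ _ (LieSubmodule.lie_mem_lie hyJ hb)
    exact (Algebra.commute_of_mem_adjoin_singleton_of_commute
      (Polynomial.aeval_mem_adjoin_singleton F _) hc.symm).symm
  have hD : ∀ k, (∀ x ∈ D (k + 2), toEnd F L M x = 0) → ∀ x ∈ D (k + 1), toEnd F L M x = 0 := by
    intro k hk x hx
    have hcent := key (D (k + 1)) (by rwa [hsucc] at hk)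
    refine toEnd_eq_zero_of_isIrreducible_of_isNilpotent (I := D (k + 1)) (fun y hy => ?_) hx
    refine isNilpotent_of_forall_trace_mul_aeval_eq_zero fun p =>
      trace_toEnd_mul_eq_zero_of_mem_lie (I := D k) (J := D k) (fun b _ => ?_) (by rwa [← hsucc])
    have hc : Commute (toEnd F L M b) (toEnd F L M y) := by
      rw [commute_iff_lie_eq, ← LieHom.map_lie]
      exact hcent _ (LieSubmodule.lie_mem_lie (LieSubmodule.mem_top b) hy)
    exact (Algebra.commute_of_mem_adjoin_singleton_of_commute
      (Polynomial.aeval_mem_adjoin_singleton F _) hc).symm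
  obtain ⟨k, hk⟩ := LieAlgebra.IsSolvable.solvable F I
  rw [LieIdeal.derivedSeries_eq_bot_iff] at hk
  have hzero : ∀ m, (∀ x ∈ D (m + 1), toEnd F L M x = 0) → ∀ x ∈ D 1, toEnd F L M x = 0 := by
    intro m
    induction m with
    | zero => exact id
    | succ m ih => exact fun h => ih (hD m h)
  refine key I (fun x hx => hzero k (fun x hx => ?_) x ?_) y hy
  · have : x ∈ (⊥ : LieIdeal F L) := hk ▸ LieAlgebra.derivedSeriesOfIdeal_succ_le I k hx
    rw [(LieSubmodule.mem_bot x).1 this, map_zero]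
  · rwa [hsucc 0]

/-- In characteristic zero, `[L, I]` acts nilpotently on every finite-dimensional module when `I`
is solvable: on each composition factor it acts by zero. -/
theorem isNilpotent_toEnd_of_mem_lie_of_isSolvable [CharZero F] [FiniteDimensional F M]
    {I : LieIdeal F L} [LieAlgebra.IsSolvable I] {y : L} (hy : y ∈ ⁅(⊤ : LieIdeal F L), I⁆) :
    IsNilpotent (toEnd F L M y) := by
  induction hd : Module.finrank F M using Nat.strong_induction_on generalizing M with
  | _ d ih =>
  subst hd
  rcases subsingleton_or_nontrivial M with hM | hM
  · exact ⟨1, LinearMap.ext fun v => Subsingleton.elim _ _⟩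
  by_cases hirr : ∀ N : LieSubmodule F L M, N ≠ ⊥ → N = ⊤
  · have := IsIrreducible.mk hirr
    rw [toEnd_eq_zero_of_isIrreducible_of_isSolvable hy]
    exact IsNilpotent.zero
  push Not at hirr
  obtain ⟨N, hbot, htop⟩ := hirr
  have hN : N.toSubmodule ≠ ⊤ := by simpa using htop
  have hN' : N.toSubmodule ≠ ⊥ := by simpa using hbot
  have hlt : Module.finrank F (M ⧸ N) < Module.finrank F M := by
    have h1 := Submodule.finrank_quotient_add_finrank N.toSubmodule
    have h2 : 0 < Module.finrank F N.toSubmodule :=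
      Nat.pos_of_ne_zero fun h => hN' (Submodule.finrank_eq_zero.1 h)
    change Module.finrank F (M ⧸ N.toSubmodule) < _
    omega
  obtain ⟨a, ha⟩ := ih _ (Submodule.finrank_lt hN) (M := N) rfl
  obtain ⟨b, hb⟩ := ih _ hlt (M := M ⧸ N) rfl
  have hsub : ∀ k (v : N), ((toEnd F L M y) ^ k) v = (((toEnd F L N y) ^ k) v : N) := by
    intro k v
    induction k with
    | zero => rfl
    | succ k ih => simp only [pow_succ', Module.End.mul_apply, ih]; rfl
  have hquot : ∀ k (v : M), LieSubmodule.Quotient.mk (N := N) (((toEnd F L M y) ^ k) v)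
      = ((toEnd F L (M ⧸ N) y) ^ k) (LieSubmodule.Quotient.mk v) := by
    intro k v
    induction k with
    | zero => rfl
    | succ k ih => simp only [pow_succ', Module.End.mul_apply, ← ih]; rfl
  refine ⟨a + b, LinearMap.ext fun v => ?_⟩
  have hv : ((toEnd F L M y) ^ b) v ∈ N := by
    rw [← LieSubmodule.Quotient.mk_eq_zero', hquot, hb, LinearMap.zero_apply]
  rw [pow_add, Module.End.mul_apply, hsub a ⟨_, hv⟩, ha]
  rfl

/-- Unlike in `isNilpotent_toEnd_sup`, the second summand `j` need not lie in an ideal of elements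
acting nilpotently: modulo `I`, the powers of `i + j` are those of `j`. -/
lemma isNilpotent_toEnd_add_of_mem [FiniteDimensional F M] {I : LieIdeal F L}
    (hI : ∀ x ∈ I, IsNilpotent (toEnd F L M x)) {i j : L} (hi : i ∈ I)
    (hj : IsNilpotent (toEnd F L M j)) : IsNilpotent (toEnd F L M (i + j)) := by
  obtain ⟨m, hm⟩ := hj
  have hnil : LieModule.IsNilpotent I M :=
    (LieModule.isNilpotent_iff_forall' (R := F)).2 fun y => hI y y.2
  obtain ⟨k, hk⟩ := (LieModule.isNilpotent_iff F I M).1 hnil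
  have step : ∀ (N : LieSubmodule F L M), ∀ v ∈ N, ∀ l : ℕ,
      ((toEnd F L M (i + j)) ^ l) v - ((toEnd F L M j) ^ l) v ∈ ⁅I, N⁆ := by
    intro N v hv l
    induction l with
    | zero => simp
    | succ l ih =>
      have hjv : ∀ l, ((toEnd F L M j) ^ l) v ∈ N := by
        intro l
        induction l with
        | zero => simpa
        | succ l ih => rw [pow_succ']; exact N.lie_mem ih
      have h1 := LieSubmodule.lie_mem_lie hi (hjv l)
      have h2 : ⁅i + j, ((toEnd F L M (i + j)) ^ l) v - ((toEnd F L M j) ^ l) v⁆ ∈ ⁅I, N⁆ :=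
        LieSubmodule.lie_mem _ ih
      convert add_mem h1 h2 using 1
      simp only [pow_succ', Module.End.mul_apply, toEnd_apply_apply, lie_sub, add_lie]
      abel
  have hlcs : ∀ l : ℕ, ∀ v : M, ((toEnd F L M (i + j)) ^ (m * l)) v ∈ I.lcs M l := by
    intro l
    induction l with
    | zero => intro v; simp
    | succ l ih =>
      intro v
      have := step _ _ (ih v) m
      rw [hm] at this
      rw [LieIdeal.lcs_succ, mul_add, mul_one, add_comm (m * l), pow_add, Module.End.mul_apply]
      simpa using this
  refine ⟨m * k, LinearMap.ext fun v => ?_⟩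
  have h := hlcs k v
  rw [← LieSubmodule.mem_toSubmodule, LieIdeal.coe_lcs_eq, hk] at h
  simpa using h

end LieTheory

/-! ### Jordan parts of tangent matrices -/

section Algebraic

/-- A decomposition of an algebra into generalized eigenspaces of a derivation is multiplicative:
`(D - (λ + μ)) (f g) = (D - λ) f * g + f * (D - μ) g`. -/
lemma Derivation.mul_mem_maxGenEigenspace {R A : Type*} [CommRing R] [CommRing A] [Algebra R A]
    (D : Derivation R A A) {a b : R} {f g : A}
    (hf : f ∈ Module.End.maxGenEigenspace (D : Module.End R A) a)
    (hg : g ∈ Module.End.maxGenEigenspace (D : Module.End R A) b) :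
    f * g ∈ Module.End.maxGenEigenspace (D : Module.End R A) (a + b) := by
  simp only [Module.End.mem_maxGenEigenspace] at hf hg ⊢
  obtain ⟨k, hk⟩ := hf
  obtain ⟨l, hl⟩ := hg
  have key : ∀ m k l : ℕ, k + l ≤ m → ∀ f g : A,
      (((D : Module.End R A) - a • 1) ^ k) f = 0 → (((D : Module.End R A) - b • 1) ^ l) g = 0 →
      (((D : Module.End R A) - (a + b) • 1) ^ m) (f * g) = 0 := by
    intro m
    induction m with
    | zero =>
      intro k l hkl f g hf _
      obtain rfl : k = 0 := by omega
      have : f = 0 := by simpa using hf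
      simp [this]
    | succ m ih =>
      intro k l hkl f g hf hg
      rcases k with _ | k
      · have : f = 0 := by simpa using hf
        simp [this]
      rcases l with _ | l
      · have : g = 0 := by simpa using hg
        simp [this]
      have hD : ((D : Module.End R A) - (a + b) • 1) (f * g)
          = ((D : Module.End R A) - a • 1) f * g + f * ((D : Module.End R A) - b • 1) g := by
        simp only [LinearMap.sub_apply, LinearMap.smul_apply, Module.End.one_apply,
          Derivation.coeFn_coe, Derivation.leibniz, smul_eq_mul]
        simp only [Algebra.smul_def, map_add]
        ring
      rw [pow_succ, Module.End.mul_apply, hD, map_add,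
        ih k (l + 1) (by omega) _ _ (by rwa [pow_succ, Module.End.mul_apply] at hf) hg,
        ih (k + 1) l (by omega) _ _ hf (by rwa [pow_succ, Module.End.mul_apply] at hg), add_zero]
  exact ⟨k + l, key _ k l le_rfl f g hk hl⟩

variable {n : ℕ} {K : Type*} [Field K]

/-- The linear form `∑ k, v k * x_{ik}` in the entries of the `i`-th row. -/
noncomputable def rowForm (i : Fin n) : (Fin n → K) →ₗ[K] MvPolynomial (Fin n × Fin n) K :=
  ∑ k, (LinearMap.proj k).smulRight (X (i, k))

lemma invDerivation_rowForm (A : Matrix (Fin n) (Fin n) K) (i : Fin n) (v : Fin n → K) :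
    invDerivation A (rowForm i v) = rowForm i (Matrix.toLin' A v) := by
  simp only [rowForm, LinearMap.sum_apply, LinearMap.smulRight_apply, LinearMap.proj_apply,
    map_sum, Derivation.map_smul, invDerivation_X, Matrix.toLin'_apply, Matrix.mulVec,
    dotProduct, Finset.smul_sum, Finset.sum_smul]
  rw [Finset.sum_comm]
  refine Finset.sum_congr rfl fun k _ => Finset.sum_congr rfl fun l _ => ?_
  rw [smul_eq_C_mul, smul_eq_C_mul, C_mul]
  ring

/-- The polynomials `f` with `D_S f = c f` in the generalized `c`-eigenspace of `D_X`, where `D_A`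
is the left-invariant derivation of the matrix `A`. -/
noncomputable def jointEigenspace (S X : Matrix (Fin n) (Fin n) K) (c : K) :
    Submodule K (MvPolynomial (Fin n × Fin n) K) :=
  Module.End.eigenspace (invDerivation S : Module.End K (MvPolynomial (Fin n × Fin n) K)) c ⊓
    Module.End.maxGenEigenspace
      (invDerivation X : Module.End K (MvPolynomial (Fin n × Fin n) K)) c

lemma rowForm_mem_jointEigenspace {S N : Matrix (Fin n) (Fin n) K} (hc : Commute S N)
    (hN : IsNilpotent N) {c : K} {v : Fin n → K}
    (hv : v ∈ Module.End.eigenspace (Matrix.toLin' S) c) (i : Fin n) :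
    rowForm i v ∈ jointEigenspace S (S + N) c := by
  have hN' : IsNilpotent (Matrix.toLin' N) := hN.map (Matrix.toLinAlgEquiv' (R := K) (n := Fin n))
  have hc' : Commute (Matrix.toLin' N) (Matrix.toLin' S) :=
    hc.symm.map (Matrix.toLinAlgEquiv' (R := K) (n := Fin n))
  obtain ⟨m, hm⟩ := hN'
  refine ⟨?_, ?_⟩
  · rw [SetLike.mem_coe, Module.End.mem_eigenspace_iff] at *
    rw [Derivation.coeFn_coe, invDerivation_rowForm, hv, map_smul]
  · rw [SetLike.mem_coe, Module.End.mem_maxGenEigenspace]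
    have key : ∀ k, (Matrix.toLin' N ^ k) v ∈ Module.End.eigenspace (Matrix.toLin' S) c ∧
        (((invDerivation (S + N) : Module.End K (MvPolynomial (Fin n × Fin n) K)) - c • 1) ^ k)
          (rowForm i v) = rowForm i ((Matrix.toLin' N ^ k) v) := by
      intro k
      induction k with
      | zero => exact ⟨hv, rfl⟩
      | succ k ih =>
        refine ⟨?_, ?_⟩
        · have h1 := ih.1
          rw [Module.End.mem_eigenspace_iff] at h1 ⊢
          rw [pow_succ', Module.End.mul_apply, ← Module.End.mul_apply, ← hc'.eq,
            Module.End.mul_apply, h1, map_smul]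
        · rw [pow_succ', Module.End.mul_apply, ih.2, pow_succ', Module.End.mul_apply]
          have h1 := ih.1
          rw [Module.End.mem_eigenspace_iff] at h1
          simp only [LinearMap.sub_apply, LinearMap.smul_apply, Module.End.one_apply,
            Derivation.coeFn_coe, invDerivation_rowForm, map_add, LinearMap.add_apply, h1,
            map_smul]
          abel
    exact ⟨m, by rw [(key m).2, hm]; simp⟩

lemma jointEigenspace_mul {S X : Matrix (Fin n) (Fin n) K} {a b : K}
    {f g : MvPolynomial (Fin n × Fin n) K} (hf : f ∈ jointEigenspace S X a)
    (hg : g ∈ jointEigenspace S X b) : f * g ∈ jointEigenspace S X (a + b) := by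
  refine ⟨?_, Derivation.mul_mem_maxGenEigenspace _ hf.2 hg.2⟩
  have h1 := hf.1
  have h2 := hg.1
  rw [SetLike.mem_coe, Module.End.mem_eigenspace_iff, Derivation.coeFn_coe] at *
  rw [Derivation.leibniz, h1, h2]
  simp only [smul_eq_mul, smul_eq_C_mul, C_add]
  ring

lemma one_mem_jointEigenspace (S X : Matrix (Fin n) (Fin n) K) :
    (1 : MvPolynomial (Fin n × Fin n) K) ∈ jointEigenspace S X 0 := by
  refine ⟨?_, ?_⟩
  · simp
  · rw [SetLike.mem_coe, Module.End.mem_maxGenEigenspace]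
    exact ⟨1, by simp⟩

/-- If `S` is diagonalizable then `K[x_{ij}]` is the sum of the joint eigenspaces: this sum is a
subalgebra, and it contains the variables. -/
lemma iSup_jointEigenspace_eq_top {S N : Matrix (Fin n) (Fin n) K} (hc : Commute S N)
    (hN : IsNilpotent N) (hS : ⨆ c, Module.End.eigenspace (Matrix.toLin' S) c = ⊤) :
    ⨆ c, jointEigenspace S (S + N) c = ⊤ := by
  set T := ⨆ c, jointEigenspace S (S + N) c with hT
  have hle : ∀ c, jointEigenspace S (S + N) c ≤ T := le_iSup (jointEigenspace S (S + N))
  have hmul : ∀ f ∈ T, ∀ g ∈ T, f * g ∈ T := by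
    intro f hf g hg
    refine Submodule.iSup_induction _ (motive := fun f => f * g ∈ T) hf (fun a f hf => ?_)
      (by simp) (fun x y hx hy => by rw [add_mul]; exact T.add_mem hx hy)
    refine Submodule.iSup_induction _ (motive := fun g => f * g ∈ T) hg (fun b g hg => ?_)
      (by simp) (fun x y hx hy => by rw [mul_add]; exact T.add_mem hx hy)
    exact hle _ (jointEigenspace_mul hf hg)
  have hrow : ∀ (i : Fin n) (v : Fin n → K), rowForm i v ∈ T := by
    intro i v
    have hv : v ∈ ⨆ c, Module.End.eigenspace (Matrix.toLin' S) c := hS ▸ Submodule.mem_top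
    refine Submodule.iSup_induction _ (motive := fun v => rowForm i v ∈ T) hv (fun a v hv => ?_)
      (by simp) (fun x y hx hy => by rw [map_add]; exact T.add_mem hx hy)
    exact hle _ (rowForm_mem_jointEigenspace hc hN hv i)
  rw [eq_top_iff]
  rintro f -
  induction f using MvPolynomial.induction_on with
  | C a =>
    have := T.smul_mem a (hle 0 (one_mem_jointEigenspace S (S + N)))
    rwa [smul_eq_C_mul, mul_one] at this
  | add p q hp hq => exact T.add_mem hp hq
  | mul_X p i hp =>
    refine hmul _ hp _ ?_
    have : rowForm (K := K) i.1 (Pi.single i.2 1) = X i := by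
      simp [rowForm, Pi.single_apply]
    rw [← this]
    exact hrow _ _

/-- A subspace `I` that is invariant under `D_X` contains, with every `f`, the components of `f` in
the generalized eigenspaces of `D_X`, hence also `D_S f`. -/
lemma invDerivation_mem_of_commute_of_isNilpotent {S N : Matrix (Fin n) (Fin n) K}
    (hc : Commute S N) (hN : IsNilpotent N)
    (hS : ⨆ c, Module.End.eigenspace (Matrix.toLin' S) c = ⊤)
    {I : Submodule K (MvPolynomial (Fin n × Fin n) K)}
    (hI : ∀ f ∈ I, invDerivation (S + N) f ∈ I) {f : MvPolynomial (Fin n × Fin n) K}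
    (hf : f ∈ I) : invDerivation S f ∈ I := by
  classical
  have hf' : f ∈ ⨆ c, jointEigenspace S (S + N) c :=
    iSup_jointEigenspace_eq_top hc hN hS ▸ Submodule.mem_top
  rw [Submodule.mem_iSup_iff_exists_finsupp] at hf'
  obtain ⟨φ, hφ, rfl⟩ := hf'
  -- `D_X` acts on the quotient by `I`, where the components of `f` add up to zero.
  let E : Module.End K (MvPolynomial (Fin n × Fin n) K ⧸ I) :=
    I.mapQ I (invDerivation (S + N) : Module.End K (MvPolynomial (Fin n × Fin n) K)) hI
  have hE : ∀ (c : K) (k : ℕ) (g : MvPolynomial (Fin n × Fin n) K),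
      ((E - c • 1) ^ k) (I.mkQ g) = I.mkQ
      ((((invDerivation (S + N) : Module.End K (MvPolynomial (Fin n × Fin n) K)) - c • 1) ^ k)
        g) := by
    intro c k g
    induction k with
    | zero => rfl
    | succ k ih =>
      rw [pow_succ', Module.End.mul_apply, ih, pow_succ', Module.End.mul_apply]
      simp [E]
  have hmem : ∀ c, I.mkQ (φ c) ∈ E.maxGenEigenspace c := by
    intro c
    obtain ⟨k, hk⟩ := (Module.End.mem_maxGenEigenspace _ _ _).1 (hφ c).2
    exact (Module.End.mem_maxGenEigenspace _ _ _).2 ⟨k, by rw [hE, hk, map_zero]⟩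
  have hcomp : ∀ c ∈ φ.support, φ c ∈ I := by
    intro c hc
    rw [← Submodule.Quotient.mk_eq_zero]
    refine (iSupIndep_iff_finsetSum_eq_zero_imp_eq_zero _).1 E.independent_maxGenEigenspace
      φ.support (fun c => I.mkQ (φ c)) (fun c _ => hmem c) ?_ c hc
    rw [← map_sum, Submodule.mkQ_apply, Submodule.Quotient.mk_eq_zero]
    exact hf
  rw [Finsupp.sum, map_sum]
  refine I.sum_mem fun c hc => ?_
  have h1 := (hφ c).1
  rw [SetLike.mem_coe, Module.End.mem_eigenspace_iff, Derivation.coeFn_coe] at h1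
  rw [h1]
  exact I.smul_mem c (hcomp c hc)

/-- A semisimple matrix over a field of characteristic zero is diagonalizable over every
algebraically closed extension, because its minimal polynomial is separable. -/
lemma iSup_eigenspace_map_eq_top {F : Type*} [Field F] [CharZero F] [Algebra F K] [IsAlgClosed K]
    {S : Matrix (Fin n) (Fin n) F} (hS : IsSemisimpleMatrix S) :
    ⨆ c, Module.End.eigenspace (Matrix.toLin' (S.map (algebraMap F K))) c = ⊤ := by
  set q := minpoly F (Matrix.toLin' S)
  have hq : (q.map (algebraMap F K)).Separable :=
    (PerfectField.separable_iff_squarefree.2 hS.minpoly_squarefree).map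
  have h1 : Polynomial.aeval S q = 0 := by
    apply (Matrix.toLinAlgEquiv' (R := F) (n := Fin n)).injective
    rw [map_zero, ← Polynomial.aeval_algHom_apply]
    exact minpoly.aeval F (Matrix.toLin' S)
  have h2 : Polynomial.aeval (S.map (algebraMap F K)) (q.map (algebraMap F K)) = 0 := by
    rw [Polynomial.aeval_map_algebraMap]
    have := Polynomial.aeval_algHom_apply (Algebra.ofId F K).mapMatrix S q
    rw [h1, map_zero] at this
    exact this
  have h3 : Polynomial.aeval (Matrix.toLin' (S.map (algebraMap F K))) (q.map (algebraMap F K))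
      = 0 := by
    have := Polynomial.aeval_algHom_apply (Matrix.toLinAlgEquiv' (R := K) (n := Fin n))
      (S.map (algebraMap F K)) (q.map (algebraMap F K))
    rw [h2, map_zero] at this
    exact this
  exact (Module.End.isSemisimple_of_squarefree_aeval_eq_zero hq.squarefree
    h3).iSup_eigenspace_eq_top

/-- The Lie algebra of a linear group contains the semisimple parts of its elements. -/
theorem mem_groupLieAlgebra_of_isJordanDecomposition {F : Type*} [Field F] [CharZero F]
    [Algebra F K] [IsAlgClosed K] {G : Subgroup (GL (Fin n) K)}
    {x s ν : Matrix (Fin n) (Fin n) F} (hJ : IsJordanDecomposition x s ν)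
    (hx : x ∈ groupLieAlgebra F G) : s ∈ groupLieAlgebra F G := by
  intro f hf
  have hmap : x.map (algebraMap F K) = s.map (algebraMap F K) + ν.map (algebraMap F K) := by
    rw [hJ.eq_add, Matrix.map_add _ (map_add _)]
  have hc : Commute (s.map (algebraMap F K)) (ν.map (algebraMap F K)) :=
    hJ.commute.map (algebraMap F K).mapMatrix
  have hν : IsNilpotent (ν.map (algebraMap F K)) := hJ.nilpotent.map (algebraMap F K).mapMatrix
  have hinv : ∀ f ∈ (groupIdeal G).restrictScalars K,
      invDerivation (s.map (algebraMap F K) + ν.map (algebraMap F K)) f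
        ∈ (groupIdeal G).restrictScalars K := by
    intro f hf
    rw [← hmap]
    exact invDerivation_mem_groupIdeal hx hf
  have := invDerivation_mem_of_commute_of_isNilpotent hc hν
    (iSup_eigenspace_map_eq_top hJ.semisimple) hinv hf
  have h1 := this _ ⟨1, G.one_mem, rfl⟩
  rw [← eval_one_invDerivation]
  simpa [aeval_eq_eval] using h1

end Algebraic

/-! ### The radical and the largest ideal of nilpotent matrices -/

section Ideals

variable {F L : Type*} [Field F] [LieRing L] [LieAlgebra F L]

/-- The ideal `I + F z`, for an element `z` that is central modulo the ideal `I`. -/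
def LieIdeal.supSpan (I : LieIdeal F L) (z : L) (hz : ∀ w : L, ⁅w, z⁆ ∈ I) : LieIdeal F L where
  toSubmodule := I.toSubmodule ⊔ Submodule.span F {z}
  lie_mem := by
    intro w m hm
    refine Submodule.mem_sup_left ?_
    obtain ⟨i, hi, _, hj, rfl⟩ := Submodule.mem_sup.1 hm
    obtain ⟨c, rfl⟩ := Submodule.mem_span_singleton.1 hj
    rw [lie_add, lie_smul]
    exact I.add_mem (I.lie_mem hi) (I.smul_mem c (hz w))

lemma LieIdeal.mem_supSpan {I : LieIdeal F L} {z : L} {hz : ∀ w : L, ⁅w, z⁆ ∈ I} {x : L} :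
    x ∈ I.supSpan z hz ↔ ∃ i ∈ I, ∃ c : F, x = i + c • z := by
  refine ⟨fun hx => ?_, ?_⟩
  · obtain ⟨i, hi, _, hj, rfl⟩ := Submodule.mem_sup.1 hx
    obtain ⟨c, rfl⟩ := Submodule.mem_span_singleton.1 hj
    exact ⟨i, hi, c, rfl⟩
  · rintro ⟨i, hi, c, rfl⟩
    exact Submodule.add_mem_sup hi (Submodule.smul_mem _ c (Submodule.mem_span_singleton_self z))

lemma LieIdeal.self_mem_supSpan {I : LieIdeal F L} {z : L} {hz : ∀ w : L, ⁅w, z⁆ ∈ I} :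
    z ∈ I.supSpan z hz :=
  LieIdeal.mem_supSpan.2 ⟨0, I.zero_mem, 1, by simp⟩

/-- An element that is central modulo the radical lies in the radical. -/
lemma mem_radical_of_forall_lie_mem [FiniteDimensional F L] {z : L}
    (hz : ∀ w : L, ⁅w, z⁆ ∈ LieAlgebra.radical F L) : z ∈ LieAlgebra.radical F L := by
  set I := LieAlgebra.radical F L
  obtain ⟨k, hk⟩ := LieAlgebra.IsSolvable.solvable F I
  rw [LieIdeal.derivedSeries_eq_bot_iff] at hk
  have hle : ⁅I.supSpan z hz, I.supSpan z hz⁆ ≤ I := by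
    rw [LieSubmodule.lie_le_iff]
    intro x _ m hm
    obtain ⟨i, hi, c, rfl⟩ := LieIdeal.mem_supSpan.1 hm
    rw [lie_add, lie_smul]
    exact I.add_mem (I.lie_mem hi) (I.smul_mem c (hz x))
  have hsolv : LieAlgebra.IsSolvable (I.supSpan z hz) := by
    refine LieAlgebra.IsSolvable.mk (R := F) (k := k + 1) ?_
    rw [LieIdeal.derivedSeries_eq_bot_iff, LieAlgebra.derivedSeriesOfIdeal_add, ← le_bot_iff, ← hk]
    refine LieAlgebra.derivedSeriesOfIdeal_mono ?_ k
    rwa [LieAlgebra.derivedSeriesOfIdeal_succ, LieAlgebra.derivedSeriesOfIdeal_zero]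
  exact (LieAlgebra.LieIdeal.solvable_iff_le_radical _ _ _).1 hsolv LieIdeal.self_mem_supSpan

variable {n : ℕ} {𝔤 : LieSubalgebra F (Matrix (Fin n) (Fin n) F)}

lemma nilIdeal_le_radical : nilIdeal 𝔤 ≤ solvableRadical 𝔤 := by
  rw [← LieAlgebra.LieIdeal.solvable_iff_le_radical]
  have hnil : LieRing.IsNilpotent (nilIdeal 𝔤) := by
    rw [LieAlgebra.isNilpotent_iff_forall (R := F)]
    intro x
    have h1 : IsNilpotent (LieAlgebra.ad F 𝔤 (x : 𝔤)) :=
      LieAlgebra.isNilpotent_ad_of_isNilpotent ((isGreatest_nilIdeal 𝔤).1 x x.2)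
    exact LieSubalgebra.isNilpotent_ad_of_isNilpotent_ad
      ((nilIdeal 𝔤).toLieSubalgebra) (x := x) h1
  infer_instance

lemma lie_mem_nilIdeal [CharZero F] {x : 𝔤} (hx : x ∈ solvableRadical 𝔤) (w : 𝔤) :
    ⁅w, x⁆ ∈ nilIdeal 𝔤 := by
  have : ⁅(⊤ : LieIdeal F 𝔤), solvableRadical 𝔤⁆ ≤ nilIdeal 𝔤 := by
    refine (isGreatest_nilIdeal 𝔤).2 fun y hy => ?_
    rw [← isNilpotent_toEnd_matrix_iff]
    exact isNilpotent_toEnd_of_mem_lie_of_isSolvable hy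
  exact this (LieSubmodule.lie_mem_lie (LieSubmodule.mem_top w) hx)

/-- The largest ideal of nilpotent matrices consists of all nilpotent matrices in the radical:
`𝔫 + F x` is an ideal of nilpotent matrices for every such matrix `x`. -/
lemma mem_nilIdeal_iff [CharZero F] {x : 𝔤} :
    x ∈ nilIdeal 𝔤 ↔ x ∈ solvableRadical 𝔤 ∧ IsNilpotent (x : Matrix (Fin n) (Fin n) F) := by
  refine ⟨fun hx => ⟨nilIdeal_le_radical hx, (isGreatest_nilIdeal 𝔤).1 x hx⟩, fun ⟨hx, hnil⟩ => ?_⟩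
  have hle : (nilIdeal 𝔤).supSpan x (lie_mem_nilIdeal hx) ≤ nilIdeal 𝔤 := by
    refine (isGreatest_nilIdeal 𝔤).2 fun y hy => ?_
    obtain ⟨i, hi, c, rfl⟩ := LieIdeal.mem_supSpan.1 hy
    rw [← isNilpotent_toEnd_matrix_iff] at hnil ⊢
    refine isNilpotent_toEnd_add_of_mem (fun z hz => ?_) hi ?_
    · rw [isNilpotent_toEnd_matrix_iff]
      exact (isGreatest_nilIdeal 𝔤).1 z hz
    · rw [map_smul]
      exact hnil.smul c
  exact hle LieIdeal.self_mem_supSpan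

end Ideals

/-! ### Jordan parts in the radical and in a Cartan subalgebra of it -/

section JordanParts

variable {F : Type*} [Field F] {n : ℕ}

/-- If `σ` is a polynomial in `T` and `T - σ` is nilpotent, then `σ` maps `Q` into `P` whenever `T`
does: on `Q / P` the operator `σ` is a nilpotent scalar, or else `P = Q`. -/
lemma apply_mem_of_mem_adjoin_of_isNilpotent_sub {V : Type*} [AddCommGroup V] [Module F V]
    {T σ : Module.End F V} (hσ : σ ∈ Algebra.adjoin F {T}) (hnil : IsNilpotent (T - σ))
    {P Q : Submodule F V} (hPQ : P ≤ Q) (hT : ∀ v ∈ Q, T v ∈ P) {v : V} (hv : v ∈ Q) :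
    σ v ∈ P := by
  have hscalar : ∃ c : F, ∀ v ∈ Q, σ v - c • v ∈ P := by
    clear hnil
    induction hσ using Algebra.adjoin_induction with
    | mem x hx =>
      obtain rfl : x = T := hx
      exact ⟨0, fun v hv => by simpa using hT v hv⟩
    | algebraMap r => exact ⟨r, fun v _ => by simp⟩
    | add A B _ _ hA hB =>
      obtain ⟨a, ha⟩ := hA
      obtain ⟨b, hb⟩ := hB
      refine ⟨a + b, fun v hv => ?_⟩
      convert P.add_mem (ha v hv) (hb v hv) using 1
      rw [LinearMap.add_apply, add_smul]
      abel
    | mul A B _ _ hA hB =>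
      obtain ⟨a, ha⟩ := hA
      obtain ⟨b, hb⟩ := hB
      refine ⟨a * b, fun v hv => ?_⟩
      have hBv : B v ∈ Q := by
        have := Q.add_mem (hPQ (hb v hv)) (Q.smul_mem b hv)
        rwa [sub_add_cancel] at this
      convert P.add_mem (ha _ hBv) (P.smul_mem a (hb v hv)) using 1
      rw [Module.End.mul_apply, smul_sub, smul_smul]
      abel
  obtain ⟨c, hc⟩ := hscalar
  have hpow : ∀ k : ℕ, ((T - σ) ^ k) v - ((-c) ^ k) • v ∈ P := by
    intro k
    induction k with
    | zero => simp
    | succ k ih =>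
      set w := ((T - σ) ^ k) v
      have hw : w ∈ Q := by
        have := Q.add_mem (hPQ ih) (Q.smul_mem ((-c) ^ k) hv)
        rwa [sub_add_cancel] at this
      convert P.add_mem (P.sub_mem (hT w hw) (hc w hw)) (P.smul_mem (-c) ih) using 1
      rw [pow_succ', Module.End.mul_apply, LinearMap.sub_apply, smul_sub, smul_smul, ← pow_succ']
      module
  obtain ⟨k, hk⟩ := hnil
  have hmem := hpow k
  rw [hk, LinearMap.zero_apply, zero_sub, neg_mem_iff] at hmem
  rcases eq_or_ne c 0 with rfl | hc0
  · simpa using hc v hv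
  · have hvP : v ∈ P := (P.smul_mem_iff (pow_ne_zero k (neg_ne_zero.2 hc0))).1 hmem
    have := P.add_mem (hc v hv) (P.smul_mem c hvP)
    rwa [sub_add_cancel] at this

namespace IsJordanDecomposition

variable {x s ν s' ν' : Matrix (Fin n) (Fin n) F}

lemma isNilpotent_toLin' (hJ : IsJordanDecomposition x s ν) : IsNilpotent (Matrix.toLin' ν) :=
  hJ.nilpotent.map (Matrix.toLinAlgEquiv' (R := F) (n := Fin n))

lemma commute_toLin' (hJ : IsJordanDecomposition x s ν) :
    Commute (Matrix.toLin' ν) (Matrix.toLin' s) :=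
  hJ.commute.symm.map (Matrix.toLinAlgEquiv' (R := F) (n := Fin n))

lemma unique [CharZero F] (hJ : IsJordanDecomposition x s ν) (hJ' : IsJordanDecomposition x s' ν') :
    s = s' ∧ ν = ν' := by
  have h := Module.End.isNilpotent_isSemisimple_unique hJ.isNilpotent_toLin' hJ.semisimple
    hJ'.isNilpotent_toLin' hJ'.semisimple hJ.commute_toLin' hJ'.commute_toLin'
    (by rw [← map_add, ← map_add, add_comm ν, add_comm ν', ← hJ.eq_add, ← hJ'.eq_add])
  exact ⟨Matrix.toLin'.injective h.2, Matrix.toLin'.injective h.1⟩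

lemma exists_of_matrix [CharZero F] (x : Matrix (Fin n) (Fin n) F) :
    ∃ s ν, IsJordanDecomposition x s ν := by
  obtain ⟨N, hN, S, hS, hnil, hss, hx⟩ :=
    Module.End.exists_isNilpotent_isSemisimple (f := Matrix.toLin' x)
  have hc : Commute S N := Algebra.commute_of_mem_adjoin_singleton_of_commute hN
    (Algebra.commute_of_mem_adjoin_self hS).symm
  let e := (Matrix.toLinAlgEquiv' (R := F) (n := Fin n))
  refine ⟨e.symm S, e.symm N, ?_, hc.map e.symm, ?_, hnil.map e.symm⟩
  · rw [add_comm, ← map_add, ← hx]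
    exact (e.symm_apply_apply x).symm
  · change Module.End.IsSemisimple (e (e.symm S))
    rwa [e.apply_symm_apply]

lemma isSemisimple_ad [CharZero F] (hs : IsSemisimpleMatrix s) :
    (LieAlgebra.ad F (Matrix (Fin n) (Fin n) F) s).IsSemisimple := by
  refine (LinearEquiv.isSemisimple_iff _
    (LieAlgebra.ad F (Module.End F (Fin n → F)) (Matrix.toLin' s)) Matrix.toLin' ?_).2
    (LieAlgebra.ad_isSemisimple_of_isSemisimple hs)
  ext1 y
  simp [LieRing.of_associative_ring_bracket, Matrix.toLin'_mul, Module.End.mul_eq_comp]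

lemma commute_ad (hJ : IsJordanDecomposition x s ν) :
    Commute (LieAlgebra.ad F (Matrix (Fin n) (Fin n) F) x)
      (LieAlgebra.ad F (Matrix (Fin n) (Fin n) F) s) := by
  refine LieAlgebra.commute_ad_of_commute ?_
  rw [hJ.eq_add]
  exact (Commute.refl s).add_left hJ.commute.symm

lemma isNilpotent_ad_sub (hJ : IsJordanDecomposition x s ν) :
    IsNilpotent (LieAlgebra.ad F (Matrix (Fin n) (Fin n) F) x
      - LieAlgebra.ad F (Matrix (Fin n) (Fin n) F) s) := by
  rw [← map_sub, hJ.eq_add, add_sub_cancel_left]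
  exact LieAlgebra.ad_nilpotent_of_nilpotent hJ.nilpotent

lemma ad_mem_adjoin [CharZero F] (hJ : IsJordanDecomposition x s ν) :
    LieAlgebra.ad F (Matrix (Fin n) (Fin n) F) s
      ∈ Algebra.adjoin F {LieAlgebra.ad F (Matrix (Fin n) (Fin n) F) x} := by
  obtain ⟨N, hN, S, hS, hnil, hss, hx⟩ :=
    (LieAlgebra.ad F (Matrix (Fin n) (Fin n) F) x).exists_isNilpotent_isSemisimple
  have hc : Commute N S := Algebra.commute_of_mem_adjoin_singleton_of_commute hS
    (Algebra.commute_of_mem_adjoin_self hN).symm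
  have h := Module.End.isNilpotent_isSemisimple_unique hnil hss hJ.isNilpotent_ad_sub
    (isSemisimple_ad hJ.semisimple) hc (hJ.commute_ad.sub_left (Commute.refl _))
    (by rw [← hx, sub_add_cancel])
  exact h.2 ▸ hS

/-- The semisimple part of `x` centralizes the generalized null space of `ad x`. -/
lemma lie_eq_zero [CharZero F] (hJ : IsJordanDecomposition x s ν)
    {w : Matrix (Fin n) (Fin n) F} {k : ℕ}
    (hw : (LieAlgebra.ad F (Matrix (Fin n) (Fin n) F) x ^ k) w = 0) : ⁅s, w⁆ = 0 := by
  have hmem : w ∈ (LieAlgebra.ad F (Matrix (Fin n) (Fin n) F) x).genEigenspace 0 k := by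
    rw [Module.End.mem_genEigenspace_nat]
    simpa using hw
  have := Module.End.apply_eq_of_mem_of_comm_of_isFinitelySemisimple_of_isNil hmem hJ.commute_ad
    (isSemisimple_ad hJ.semisimple).isFinitelySemisimple hJ.isNilpotent_ad_sub
  simpa using this

end IsJordanDecomposition

variable {𝔤 : LieSubalgebra F (Matrix (Fin n) (Fin n) F)}

/-- If a matrix Lie algebra contains the semisimple parts of its elements, then so does its
radical. -/
lemma exists_radical_eq_of_isJordanDecomposition [CharZero F]
    (hcl : ∀ x s ν, IsJordanDecomposition x s ν → x ∈ 𝔤 → s ∈ 𝔤) {x : solvableRadical 𝔤}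
    {s ν : Matrix (Fin n) (Fin n) F}
    (hJ : IsJordanDecomposition (inclLie 𝔤 (inclRad 𝔤 x)) s ν) :
    ∃ y : solvableRadical 𝔤, inclLie 𝔤 (inclRad 𝔤 y) = s := by
  have hs : s ∈ 𝔤 := hcl _ _ _ hJ (x : 𝔤).2
  refine ⟨⟨⟨s, hs⟩, mem_radical_of_forall_lie_mem fun w => ?_⟩, rfl⟩
  let P := (solvableRadical 𝔤).toSubmodule.map (inclLie 𝔤)
  have hP : ∀ z : 𝔤, inclLie 𝔤 z ∈ P → z ∈ solvableRadical 𝔤 := by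
    rintro z ⟨z', hz', hzz'⟩
    rwa [← Subtype.ext (a1 := z') (a2 := z) hzz']
  have hPQ : P ≤ 𝔤.toSubmodule := by
    rintro _ ⟨z, -, rfl⟩
    exact z.2
  have := apply_mem_of_mem_adjoin_of_isNilpotent_sub hJ.ad_mem_adjoin hJ.isNilpotent_ad_sub hPQ
    (fun v hv => ⟨⁅(x : 𝔤), ⟨v, hv⟩⁆, lie_mem_left F 𝔤 _ _ _ x.2, rfl⟩)
    (v := (w : Matrix _ _ F)) w.2
  rw [← lie_skew]
  exact neg_mem (hP ⁅(⟨s, hs⟩ : 𝔤), w⁆ this)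

lemma ad_pow_incl (x w : solvableRadical 𝔤) (k : ℕ) :
    (LieAlgebra.ad F (Matrix (Fin n) (Fin n) F) (inclLie 𝔤 (inclRad 𝔤 x)) ^ k)
      (inclLie 𝔤 (inclRad 𝔤 w))
      = inclLie 𝔤 (inclRad 𝔤 ((LieAlgebra.ad F (solvableRadical 𝔤) x ^ k) w)) := by
  induction k with
  | zero => rfl
  | succ k ih => rw [pow_succ', Module.End.mul_apply, ih, pow_succ', Module.End.mul_apply]; rfl

lemma incl_injective : Function.Injective fun x : solvableRadical 𝔤 => inclLie 𝔤 (inclRad 𝔤 x) :=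
  fun _ _ h => Subtype.ext (Subtype.ext h)

variable (h : LieSubalgebra F (solvableRadical 𝔤))

lemma ad_pow_coe (x w : h) (k : ℕ) :
    (LieAlgebra.ad F (solvableRadical 𝔤) x ^ k) w = ((LieAlgebra.ad F h x ^ k) w : h) := by
  induction k with
  | zero => rfl
  | succ k ih => rw [pow_succ', Module.End.mul_apply, ih, pow_succ', Module.End.mul_apply]; rfl

variable {h}

set_option synthInstance.maxHeartbeats 200000 in
/-- The semisimple part of an element of a nilpotent subalgebra centralizes this subalgebra. -/
lemma lie_eq_zero_of_isJordanDecomposition [CharZero F] [LieRing.IsNilpotent h]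
    {x y w : solvableRadical 𝔤}
    (hx : x ∈ h) (hw : w ∈ h) {ν : Matrix (Fin n) (Fin n) F}
    (hJ : IsJordanDecomposition (inclLie 𝔤 (inclRad 𝔤 x)) (inclLie 𝔤 (inclRad 𝔤 y)) ν) :
    ⁅y, w⁆ = 0 := by
  obtain ⟨k, hk⟩ := LieModule.isNilpotent_toEnd_of_isNilpotent F h h ⟨x, hx⟩
  refine incl_injective (hJ.lie_eq_zero (k := k) (w := inclLie 𝔤 (inclRad 𝔤 w)) ?_)
  have hk' : (LieAlgebra.ad F h ⟨x, hx⟩ ^ k) ⟨w, hw⟩ = 0 := by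
    change (LieModule.toEnd F h h ⟨x, hx⟩ ^ k) ⟨w, hw⟩ = 0
    rw [hk, LinearMap.zero_apply]
  have := ad_pow_coe h ⟨x, hx⟩ ⟨w, hw⟩ k
  rw [hk'] at this
  rw [ad_pow_incl, this]
  rfl

lemma isJordanDecomposition_self {x : Matrix (Fin n) (Fin n) F} (hx : IsSemisimpleMatrix x) :
    IsJordanDecomposition x x 0 :=
  ⟨(add_zero x).symm, Commute.zero_right x, hx, IsNilpotent.zero⟩

lemma lie_eq_zero_of_isSemisimpleMatrix [CharZero F] [LieRing.IsNilpotent h]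
    {y w : solvableRadical 𝔤}
    (hy : y ∈ h) (hw : w ∈ h) (hss : IsSemisimpleMatrix (inclLie 𝔤 (inclRad 𝔤 y))) : ⁅y, w⁆ = 0 :=
  lie_eq_zero_of_isJordanDecomposition hy hw (isJordanDecomposition_self hss)

lemma commute_incl_of_lie_eq_zero {x y : solvableRadical 𝔤} (hxy : ⁅x, y⁆ = 0) :
    Commute (inclLie 𝔤 (inclRad 𝔤 x)) (inclLie 𝔤 (inclRad 𝔤 y)) := by
  rw [commute_iff_lie_eq]
  exact congrArg (fun z => inclLie 𝔤 (inclRad 𝔤 z)) hxy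

variable (h)

set_option synthInstance.maxHeartbeats 200000 in
/-- The semisimple matrices in a nilpotent subalgebra `h`; they are central in `h`, hence form a
subalgebra. -/
def semisimpleSubalgebra [CharZero F] [LieRing.IsNilpotent h] :
    LieSubalgebra F (solvableRadical 𝔤) where
  carrier := {y | y ∈ h ∧ IsSemisimpleMatrix (inclLie 𝔤 (inclRad 𝔤 y))}
  zero_mem' := ⟨h.zero_mem, by simp [IsSemisimpleMatrix]⟩
  add_mem' := by
    rintro x y ⟨hx, hxs⟩ ⟨hy, hys⟩
    refine ⟨h.add_mem hx hy, ?_⟩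
    have hc := (commute_incl_of_lie_eq_zero (lie_eq_zero_of_isSemisimpleMatrix hx hy hxs)).map
      (Matrix.toLinAlgEquiv' (R := F) (n := Fin n))
    rw [IsSemisimpleMatrix, map_add, map_add, map_add]
    exact Module.End.IsSemisimple.add_of_commute hc hxs hys
  smul_mem' := by
    rintro c x ⟨hx, hxs⟩
    refine ⟨h.smul_mem c hx, ?_⟩
    rw [IsSemisimpleMatrix, map_smul, map_smul, map_smul]
    exact Module.End.IsSemisimple_smul c hxs
  lie_mem' := by
    rintro x y ⟨hx, hxs⟩ ⟨hy, -⟩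
    have h0 : ⁅x, y⁆ = 0 := lie_eq_zero_of_isSemisimpleMatrix hx hy hxs
    rw [h0]
    exact ⟨h.zero_mem, by simp [IsSemisimpleMatrix]⟩

variable {h}

variable [h.IsCartanSubalgebra]

/-- The Jordan parts of an element of a Cartan subalgebra `h` of the radical lie in `h`: the
semisimple part normalizes `h`. -/
lemma exists_semisimple_add_nilpotent [CharZero F]
    (hcl : ∀ x s ν, IsJordanDecomposition x s ν → x ∈ 𝔤 → s ∈ 𝔤) {x : solvableRadical 𝔤}
    (hx : x ∈ h) : ∃ y ∈ semisimpleSubalgebra h, ∃ z ∈ h, inclRad 𝔤 z ∈ nilIdeal 𝔤 ∧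
      x = y + z := by
  obtain ⟨s, ν, hJ⟩ := IsJordanDecomposition.exists_of_matrix (inclLie 𝔤 (inclRad 𝔤 x))
  obtain ⟨y, rfl⟩ := exists_radical_eq_of_isJordanDecomposition hcl hJ
  have hy : y ∈ h := by
    rw [← LieSubalgebra.IsCartanSubalgebra.self_normalizing (H := h),
      LieSubalgebra.mem_normalizer_iff]
    intro w hw
    rw [lie_eq_zero_of_isJordanDecomposition hx hw hJ]
    exact h.zero_mem
  refine ⟨y, ⟨hy, hJ.semisimple⟩, x - y, h.sub_mem hx hy, ?_, (add_sub_cancel y x).symm⟩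
  rw [mem_nilIdeal_iff]
  refine ⟨(x - y).2, ?_⟩
  have : inclLie 𝔤 (inclRad 𝔤 (x - y)) = ν := by
    rw [map_sub, map_sub, hJ.eq_add, add_sub_cancel_left]
  change IsNilpotent (inclLie 𝔤 (inclRad 𝔤 (x - y)))
  rw [this]
  exact hJ.nilpotent

lemma posFittingComp_le_nilIdeal [CharZero F] {b : solvableRadical 𝔤}
    (hb : b ∈ LieModule.posFittingComp F h (solvableRadical 𝔤)) : inclRad 𝔤 b ∈ nilIdeal 𝔤 := by
  have h1 := LieModule.posFittingComp_le_iInf_lowerCentralSeries F h (solvableRadical 𝔤) hb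
  have h2 : b ∈ LieModule.lowerCentralSeries F h (solvableRadical 𝔤) 1 :=
    (LieSubmodule.mem_iInf _).1 h1 1
  rw [LieModule.lowerCentralSeries_succ, LieModule.lowerCentralSeries_zero,
    ← LieSubmodule.mem_toSubmodule, LieSubmodule.lieIdeal_oper_eq_linear_span'] at h2
  clear h1 hb
  induction h2 using Submodule.span_induction with
  | mem b hb =>
    obtain ⟨x, -, m, -, rfl⟩ := hb
    exact lie_mem_nilIdeal m.2 (x : solvableRadical 𝔤)
  | zero => exact (nilIdeal 𝔤).zero_mem
  | add x y _ _ hx hy => exact (nilIdeal 𝔤).add_mem hx hy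
  | smul c x _ hx => exact (nilIdeal 𝔤).smul_mem c hx

/-- The Fitting decomposition of the radical under a Cartan subalgebra. -/
lemma exists_eq_add_posFittingComp (x : solvableRadical 𝔤) :
    ∃ a ∈ h, ∃ b ∈ LieModule.posFittingComp F h (solvableRadical 𝔤), x = a + b := by
  have hcompl := LieModule.isCompl_genWeightSpace_zero_posFittingComp F h (solvableRadical 𝔤)
  have hx : x ∈ LieAlgebra.rootSpace h (0 : h → F) ⊔
      LieModule.posFittingComp F h (solvableRadical 𝔤) := by
    rw [hcompl.sup_eq_top]
    exact LieSubmodule.mem_top x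
  obtain ⟨a, ha, b, hb, rfl⟩ := (LieSubmodule.mem_sup _ _ _).1 hx
  rw [LieAlgebra.rootSpace_zero_eq] at ha
  exact ⟨a, ha, b, hb, rfl⟩

/-- The semisimple matrices in `h` form a toral complement. Their centralizer is `h`, because each
element of `h` acts on this centralizer like its nilpotent part. -/
theorem isToralComplement_semisimpleSubalgebra [CharZero F]
    (hcl : ∀ x s ν, IsJordanDecomposition x s ν → x ∈ 𝔤 → s ∈ 𝔤) :
    IsToralComplement 𝔤 h (semisimpleSubalgebra h) := by
  have hcent : ∀ x, x ∈ h ↔ ∀ y ∈ semisimpleSubalgebra h, ⁅y, x⁆ = 0 := by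
    refine fun x => ⟨fun hx y hy => lie_eq_zero_of_isSemisimpleMatrix hy.1 hx hy.2, fun hx => ?_⟩
    have hmem : x ∈ LieAlgebra.rootSpace h (0 : h → F) := by
      rw [LieModule.mem_genWeightSpace]
      intro w
      obtain ⟨y, hy, z, hz, hzn, hw⟩ := exists_semisimple_add_nilpotent hcl w.2
      have hyz : ⁅y, z⁆ = 0 := lie_eq_zero_of_isSemisimpleMatrix hy.1 hz hy.2
      obtain ⟨k, hk⟩ : IsNilpotent (LieAlgebra.ad F (Matrix (Fin n) (Fin n) F)
          (inclLie 𝔤 (inclRad 𝔤 z))) :=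
        LieAlgebra.ad_nilpotent_of_nilpotent (mem_nilIdeal_iff.1 hzn).2
      have hpow : ∀ k, ⁅y, (LieAlgebra.ad F (solvableRadical 𝔤) z ^ k) x⁆ = 0 ∧
          (LieModule.toEnd F h (solvableRadical 𝔤) w ^ k) x
            = (LieAlgebra.ad F (solvableRadical 𝔤) z ^ k) x := by
        intro k
        induction k with
        | zero => exact ⟨hx y hy, rfl⟩
        | succ k ih =>
          rw [pow_succ', Module.End.mul_apply, pow_succ', Module.End.mul_apply, ih.2,
            LieAlgebra.ad_apply]
          refine ⟨?_, ?_⟩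
          · rw [leibniz_lie, hyz, zero_lie, ih.1, lie_zero, add_zero]
          · change ⁅(w : solvableRadical 𝔤), _⁆ = _
            rw [hw, add_lie, ih.1, zero_add]
      refine ⟨k, ?_⟩
      rw [Pi.zero_apply, zero_smul, sub_zero, (hpow k).2]
      apply incl_injective
      simp only [← ad_pow_incl, hk]
      rfl
    rw [LieAlgebra.rootSpace_zero_eq] at hmem
    exact hmem
  refine ⟨fun x hx y hy => lie_eq_zero_of_isSemisimpleMatrix hx.1 hy.1 hx.2, fun x hx => hx.2,
    le_antisymm (sup_le ?_ nilIdeal_le_radical) ?_, ?_, hcent, fun x => ⟨fun hx => ?_, ?_⟩⟩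
  · rintro _ ⟨x, -, rfl⟩
    exact x.2
  · intro x hx
    obtain ⟨a, ha, b, hb, hab⟩ := exists_eq_add_posFittingComp (h := h) ⟨x, hx⟩
    obtain ⟨y, hy, z, hz, hzn, rfl⟩ := exists_semisimple_add_nilpotent hcl ha
    have hx' : x = inclRad 𝔤 y + (inclRad 𝔤 z + inclRad 𝔤 b) := by
      rw [← add_assoc, ← map_add, ← map_add, ← hab]
      rfl
    rw [hx']
    exact Submodule.add_mem_sup ⟨y, hy, rfl⟩
      ((nilIdeal 𝔤).add_mem hzn (posFittingComp_le_nilIdeal hb))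
  · rw [Submodule.disjoint_def]
    rintro _ ⟨y, hy, rfl⟩ hyn
    have hnil : IsNilpotent (Matrix.toLin' (inclLie 𝔤 (inclRad 𝔤 y))) :=
      (mem_nilIdeal_iff.1 hyn).2.map (Matrix.toLinAlgEquiv' (R := F) (n := Fin n))
    have h0 := Module.End.eq_zero_of_isNilpotent_isSemisimple hnil hy.2
    rw [LinearEquiv.map_eq_zero_iff] at h0
    exact Subtype.ext h0
  · obtain ⟨y, hy, z, hz, hzn, rfl⟩ := exists_semisimple_add_nilpotent hcl hx
    exact ⟨y, hy, z, hzn, (hcent z).1 hz, rfl⟩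
  · rintro ⟨y, hy, z, -, hz, rfl⟩
    exact h.add_mem hy.1 ((hcent z).2 hz)

end JordanParts

/-! ### The spans of the Jordan parts of a basis -/

section Spans

variable {F : Type*} [Field F] {n : ℕ}
  {𝔤 : LieSubalgebra F (Matrix (Fin n) (Fin n) F)} {h d : LieSubalgebra F (solvableRadical 𝔤)}

/-- Every toral complement contains the semisimple parts of the elements of `h`. -/
lemma IsToralComplement.exists_of_isJordanDecomposition [CharZero F]
    (hd : IsToralComplement 𝔤 h d) {x : solvableRadical 𝔤} (hx : x ∈ h)
    {s ν : Matrix (Fin n) (Fin n) F}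
    (hJ : IsJordanDecomposition (inclLie 𝔤 (inclRad 𝔤 x)) s ν) :
    ∃ y ∈ d, ∃ z, inclRad 𝔤 z ∈ nilIdeal 𝔤 ∧ x = y + z ∧ inclLie 𝔤 (inclRad 𝔤 y) = s ∧
      inclLie 𝔤 (inclRad 𝔤 z) = ν := by
  obtain ⟨y, hy, z, hzn, hz, rfl⟩ := (hd.eq_add x).1 hx
  have hJ' : IsJordanDecomposition (inclLie 𝔤 (inclRad 𝔤 (y + z))) (inclLie 𝔤 (inclRad 𝔤 y))
      (inclLie 𝔤 (inclRad 𝔤 z)) :=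
    ⟨by rw [map_add, map_add], commute_incl_of_lie_eq_zero (hz y hy), hd.semisimple y hy,
      (mem_nilIdeal_iff.1 hzn).2⟩
  exact ⟨y, hy, z, hzn, rfl, hJ'.unique hJ⟩

lemma IsToralComplement.eq_zero (hd : IsToralComplement 𝔤 h d) {y : solvableRadical 𝔤}
    (hy : y ∈ d) (hyn : inclRad 𝔤 y ∈ nilIdeal 𝔤) : y = 0 :=
  Subtype.ext ((Submodule.disjoint_def.1 hd.disjoint) _ ⟨y, hy, rfl⟩ hyn)

lemma sum_smul_mem_span_range {V : Type*} [AddCommGroup V] [Module F V] {r : ℕ} (c : Fin r → F)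
    (v : Fin r → V) : ∑ i, c i • v i ∈ Submodule.span F (Set.range v) :=
  sum_mem fun i _ => Submodule.smul_mem _ _ (Submodule.subset_span ⟨i, rfl⟩)

variable [CharZero F] {r : ℕ} (a : Module.Basis (Fin r) F h)
  {s ν : Fin r → Matrix (Fin n) (Fin n) F}

set_option synthInstance.maxHeartbeats 200000 in
lemma IsToralComplement.exists_sum_eq (hd : IsToralComplement 𝔤 h d)
    (hJ : ∀ i, IsJordanDecomposition (inclLie 𝔤 (inclRad 𝔤 (a i))) (s i) (ν i))
    {x : solvableRadical 𝔤} (hx : x ∈ h) :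
    ∃ c : Fin r → F, ∃ y ∈ d, ∃ z, inclRad 𝔤 z ∈ nilIdeal 𝔤 ∧ x = y + z ∧
      inclLie 𝔤 (inclRad 𝔤 y) = ∑ i, c i • s i ∧ inclLie 𝔤 (inclRad 𝔤 z) = ∑ i, c i • ν i := by
  choose y hy z hz hyz hys hzν using fun i => hd.exists_of_isJordanDecomposition (a i).2 (hJ i)
  refine ⟨fun i => a.repr ⟨x, hx⟩ i, ∑ i, a.repr ⟨x, hx⟩ i • y i,
    sum_mem fun i _ => d.smul_mem _ (hy i), ∑ i, a.repr ⟨x, hx⟩ i • z i, ?_, ?_, ?_, ?_⟩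
  · rw [map_sum]
    exact sum_mem fun i _ => by rw [map_smul]; exact (nilIdeal 𝔤).smul_mem _ (hz i)
  · rw [← Finset.sum_add_distrib]
    have := congrArg (Subtype.val) (a.sum_repr ⟨x, hx⟩)
    rw [AddSubmonoidClass.coe_finsetSum] at this
    refine this.symm.trans (Finset.sum_congr rfl fun i _ => ?_)
    rw [← smul_add, ← hyz]
    rfl
  · simp only [map_sum, map_smul, hys]
  · simp only [map_sum, map_smul, hzν]

theorem IsToralComplement.map_eq_span (hd : IsToralComplement 𝔤 h d)
    (hJ : ∀ i, IsJordanDecomposition (inclLie 𝔤 (inclRad 𝔤 (a i))) (s i) (ν i)) :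
    (d.toSubmodule.map (inclRad 𝔤)).map (inclLie 𝔤) = Submodule.span F (Set.range s) := by
  refine le_antisymm ?_ (Submodule.span_le.2 ?_)
  · rintro _ ⟨_, ⟨x, hx, rfl⟩, rfl⟩
    have hxh : x ∈ h := (hd.eq_centralizer x).2 fun y hy => hd.abelian y hy x hx
    obtain ⟨c, y, hy, z, hz, rfl, hyc, -⟩ := hd.exists_sum_eq a hJ hxh
    have hz0 : z = 0 := hd.eq_zero (by simpa using d.sub_mem hx hy) hz
    rw [hz0, add_zero, hyc]
    exact sum_smul_mem_span_range c s
  · rintro _ ⟨i, rfl⟩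
    obtain ⟨y, hy, -, -, -, hys, -⟩ := hd.exists_of_isJordanDecomposition (a i).2 (hJ i)
    exact ⟨_, ⟨y, hy, rfl⟩, hys⟩

theorem IsToralComplement.map_nilIdeal_eq [h.IsCartanSubalgebra] (hd : IsToralComplement 𝔤 h d)
    (hJ : ∀ i, IsJordanDecomposition (inclLie 𝔤 (inclRad 𝔤 (a i))) (s i) (ν i)) :
    (nilIdeal 𝔤).toSubmodule.map (inclLie 𝔤) =
      Submodule.span F (Set.range ν) ⊔
        ((LieModule.posFittingComp F h (solvableRadical 𝔤)).toSubmodule.map (inclRad 𝔤)).map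
          (inclLie 𝔤) := by
  refine le_antisymm ?_ (sup_le (Submodule.span_le.2 ?_) ?_)
  · rintro _ ⟨x, hx, rfl⟩
    obtain ⟨u, hu, b, hb, hub⟩ :=
      exists_eq_add_posFittingComp (h := h) ⟨x, nilIdeal_le_radical hx⟩
    obtain ⟨c, y, hy, z, hz, rfl, -, hzc⟩ := hd.exists_sum_eq a hJ hu
    have hx' : x = inclRad 𝔤 y + inclRad 𝔤 z + inclRad 𝔤 b := by
      rw [← map_add, ← map_add, ← hub]
      rfl
    have hy0 : y = 0 := by
      refine hd.eq_zero hy ?_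
      have : inclRad 𝔤 y = x - inclRad 𝔤 z - inclRad 𝔤 b := by rw [hx']; abel
      rw [this]
      exact sub_mem (sub_mem hx hz) (posFittingComp_le_nilIdeal hb)
    rw [hx', hy0, map_zero, zero_add, map_add, hzc]
    exact Submodule.add_mem_sup (sum_smul_mem_span_range c ν) ⟨_, ⟨b, hb, rfl⟩, rfl⟩
  · rintro _ ⟨i, rfl⟩
    obtain ⟨-, -, z, hz, -, -, hzν⟩ := hd.exists_of_isJordanDecomposition (a i).2 (hJ i)
    exact ⟨_, hz, hzν⟩
  · rintro _ ⟨_, ⟨b, hb, rfl⟩, rfl⟩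
    exact ⟨_, posFittingComp_le_nilIdeal hb, rfl⟩

end Spans

theorem mainTheorem4 {F K : Type*} [Field F] [CharZero F] [Field K] [Algebra F K]
    [IsAlgClosure F K] {n : ℕ} (G : Subgroup (GL (Fin n) K)) (hG : IsAlgebraicSubgroup G)
    (hGF : IsDefinedOver F G)
    (𝔤 : LieSubalgebra F (Matrix (Fin n) (Fin n) F)) (h𝔤 : 𝔤 = groupLieAlgebra F G)
    (h : LieSubalgebra F (solvableRadical 𝔤)) [h.IsCartanSubalgebra]
    {r : ℕ} (a : Module.Basis (Fin r) F h) (s ν : Fin r → Matrix (Fin n) (Fin n) F)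
    (hJ : ∀ i, IsJordanDecomposition (inclLie 𝔤 (inclRad 𝔤 (a i))) (s i) (ν i)) :
    (∃ d : LieSubalgebra F (solvableRadical 𝔤), IsToralComplement 𝔤 h d) ∧
    (∀ d : LieSubalgebra F (solvableRadical 𝔤), IsToralComplement 𝔤 h d →
      (d.toSubmodule.map (inclRad 𝔤)).map (inclLie 𝔤) = Submodule.span F (Set.range s)) ∧
    (nilIdeal 𝔤).toSubmodule.map (inclLie 𝔤) =
      Submodule.span F (Set.range ν) ⊔
        ((LieModule.posFittingComp F h (solvableRadical 𝔤)).toSubmodule.map (inclRad 𝔤)).map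
          (inclLie 𝔤) := by
  have : IsAlgClosed K := IsAlgClosure.isAlgClosed F
  have hcl : ∀ x s ν, IsJordanDecomposition x s ν → x ∈ 𝔤 → s ∈ 𝔤 := by
    subst h𝔤
    exact fun x s ν hJ hx => mem_groupLieAlgebra_of_isJordanDecomposition hJ hx
  have hd := isToralComplement_semisimpleSubalgebra (h := h) hcl
  exact ⟨⟨_, hd⟩, fun d hd => hd.map_eq_span a hJ, hd.map_nilIdeal_eq a hJ⟩
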